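/- Let $A$ be a finite-dimensional real alternative algebra with unity $1$, equipped with a real linear anti-involution $x\mapsto x^c$; identify $r\in\mathbb R$ with $r1\in A$. Put $t(x)=x+x^c$, $n(x)=xx^c$, and let $$Q_A=\mathbb R\cup\{x\in A \mid t(x)\in\mathbb R,\ n(x)\in\mathbb R,\ 4n(x)>t(x)^2\}$$ be the quadratic cone, $\mathbb S_A=\{J\in Q_A\mid J^2=-1\}$, and $\mathbb C_J=\{\alpha+\beta J\mid\alpha,\beta\in\mathbb R\}$ for $J\in\mathbb S_A$. Assume that $A$ carries a norm $\|\cdot\|$ with $\|x\|=\sqrt{n(x)}$ for all $x\in Q_A$. Let $D\subseteq\mathbb C$ be a non-empty open set invariant under complex conjugation and let $$O_D=\{\alpha+\beta J \mid \alpha,\beta\in\mathbb R,\ \alpha+i\beta\in D,\ J\in\mathbb S_A\}\subseteq Q_A .$$ Assume that $O_D$ is (non-empty and) connected. A stem function on $D$ is a map $F=F_1+iF_2:D\to A\otimes_{\mathbb R}\mathbb C$, with $F_1,F_2:D\to A$, such that $F_1(\bar z)=F_1(z)$ and $F_2(\bar z)=-F_2(z)$. It induces the function $\mathcal I(F):O_D\to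 A$, $\mathcal I(F)(\alpha+\beta J)=F_1(\alpha+i\beta)+J\,F_2(\alpha+i\beta)$. A function $f:O_D\to A$ is a slice function if $f=\mathcal I(F)$ for some stem function $F$; it is slice regular if moreover $F$ can be chosen of class $C^1$ with $\mathcal I(\partial F/\partial\bar z)=0$ on $O_D$, where $\partial F/\partial\bar z=\frac12(\partial F/\partial\alpha+i\,\partial F/\partial\beta)$. For $y\in Q_A$ and $n\in\mathbb N$ let $(x-y)^{\cdot n}$ be the value at $x\in Q_A$ of the slice function induced by the stem function $z\mapsto(z-y)^n$. With $\mathrm{re}(x)=(x+x^c)/2$ and $\mathrm{im}(x)=(x-x^c)/2$, let, for $x,y\in Q_A$, $\sigma_A(x,y)=\|x-y\|$ if $x$ and $y$ lie in a common $\mathbb C_J$, $J\in\mathbb S_A$, and $$\sigma_A(x,y)=\sqrt{|\mathrm{re}(x)-\mathrm{re}(y)|^2+(\|\mathrm{im}(x)\|+\|\mathrm{im}(y)\|)^2}$$ otherwise; let $\Sigma_A(y,r)=\{x\in Q_A\mid\sigma_A(x,y)<r\}$. A function $f:O_D\to A$ is $\sigma_A$-analytic if for every $y\in O_D$ there are $r>0$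 with $\Sigma_A(y,r)\subseteq O_D$ and a sequence $(a_n)$ in $A$ such that the series $\sum_{n=0}^\infty (x-y)^{\cdot n}a_n$ converges to $f(x)$ for every $x\in\Sigma_A(y,r)$. Theorem. Let $f:O_D\to A$ be any function. (i) If $D\cap\mathbb R=\emptyset$, then $f$ is slice regular if and only if $f$ is a slice function and is $\sigma_A$-analytic. (ii) If $D\cap\mathbb R\neq\emptyset$, then $f$ is slice regular if and only if $f$ is $\sigma_A$-analytic. -/

import Mathlib

open Filter Topology

noncomputable section

namespace SliceAnalysis

/-- A unital, not necessarily associative ring whose additive group carries a norm. No inequality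
between the norm and the product is required. -/
class NormedNonAssocRing (A : Type*) extends Norm A, NonAssocRing A, MetricSpace A where
  dist_eq : ∀ x y : A, dist x y = ‖-x + y‖

instance (priority := 100) NormedNonAssocRing.toNormedAddCommGroup {A : Type*}
    [h : NormedNonAssocRing A] : NormedAddCommGroup A :=
  { h with }

/-- `A` is alternative: `x (x y) = (x x) y` and `(x y) y = x (y y)`. -/
class IsAlternative (A : Type*) [NonAssocRing A] : Prop where
  left_alternative : ∀ x y : A, x * (x * y) = (x * x) * y
  right_alternative : ∀ x y : A, (x * y) * y = x * (y * y)

section Cone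

variable (A : Type*) [NonAssocRing A] [Module ℝ A] [StarRing A]

/-- The quadratic cone `Q_A = ℝ ∪ {x | t(x) ∈ ℝ, n(x) ∈ ℝ, 4 n(x) > t(x)²}`, where
`t(x) = x + xᶜ`, `n(x) = x xᶜ`, `xᶜ = star x`, and a real number `r` is identified with `r • 1`. -/
def quadraticCone : Set A :=
  {x | ∃ r : ℝ, x = r • (1 : A)} ∪
    {x | ∃ t n : ℝ, x + star x = t • (1 : A) ∧ x * star x = n • (1 : A) ∧ 4 * n > t ^ 2}

/-- The set `S_A` of the square roots of `-1` in the quadratic cone. -/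
def imaginaryUnits : Set A :=
  {J | J ∈ quadraticCone A ∧ J * J = -1}

variable {A}

/-- `Φ_J(α + iβ) = α + β J`. -/
def Phi (J : A) (z : ℂ) : A := z.re • (1 : A) + z.im • J

/-- The slice `ℂ_J = {α + β J | α, β ∈ ℝ}`. -/
def slice (J : A) : Set A := {x | ∃ α β : ℝ, x = α • (1 : A) + β • J}

/-- `re(x) = (x + xᶜ) / 2`, as an element of `A`. -/
def rePart (x : A) : A := (1 / 2 : ℝ) • (x + star x)

/-- `im(x) = (x - xᶜ) / 2`. -/
def imPart (x : A) : A := (1 / 2 : ℝ) • (x - star x)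

variable (A)

/-- The circular set `O_D` of `Q_A` defined by `D ⊆ ℂ`. -/
def circularSet (D : Set ℂ) : Set A :=
  {x | x ∈ quadraticCone A ∧ ∃ z ∈ D, ∃ J ∈ imaginaryUnits A, x = Phi J z}

end Cone

/-- The complexification `A ⊗ ℂ = {x + i y | x, y ∈ A}`. -/
@[ext]
structure Complexification (A : Type*) where
  re : A
  im : A

namespace Complexification

variable {A : Type*} [NonAssocRing A]

instance : One (Complexification A) := ⟨⟨1, 0⟩⟩

instance : Mul (Complexification A) :=
  ⟨fun v w => ⟨v.re * w.re - v.im * w.im, v.re * w.im + v.im * w.re⟩⟩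

/-- The complex conjugation `x + i y ↦ x - i y`. -/
def conj (w : Complexification A) : Complexification A := ⟨w.re, -w.im⟩

/-- Powers of an element (`A ⊗ ℂ` is alternative whenever `A` is, so the bracketing
is immaterial there). -/
def pow (w : Complexification A) : ℕ → Complexification A
  | 0 => 1
  | n + 1 => pow w n * w

@[simp] theorem one_re : (1 : Complexification A).re = 1 := rfl
@[simp] theorem one_im : (1 : Complexification A).im = 0 := rfl
@[simp] theorem mul_re (v w : Complexification A) :
    (v * w).re = v.re * w.re - v.im * w.im := rfl
@[simp] theorem mul_im (v w : Complexification A) :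
    (v * w).im = v.re * w.im + v.im * w.re := rfl
@[simp] theorem conj_re (w : Complexification A) : w.conj.re = w.re := rfl
@[simp] theorem conj_im (w : Complexification A) : w.conj.im = -w.im := rfl

theorem conj_mul (v w : Complexification A) : (v * w).conj = v.conj * w.conj := by
  ext <;> simp <;> abel

theorem conj_pow (w : Complexification A) (n : ℕ) : (w.pow n).conj = w.conj.pow n := by
  induction n with
  | zero => ext <;> simp [pow]
  | succ n ih => rw [pow, pow, conj_mul, ih]

end Complexification

section Slice

variable {A : Type*} [NonAssocRing A] [Module ℝ A] [StarRing A]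

/-- `F : D → A ⊗ ℂ` is a stem function: `F(z̄)` is the conjugate of `F(z)` for `z ∈ D`. -/
def IsStemOn (D : Set ℂ) (F : ℂ → Complexification A) : Prop :=
  ∀ z ∈ D, F (starRingEnd ℂ z) = (F z).conj

open Classical in
/-- The function `I(F)` induced by a stem function `F = F₁ + i F₂`:
`I(F)(x) = F₁(z) + J F₂(z)` if `x = Φ_J(z)` with `J ∈ S_A`. It does not depend on the
representation of `x`, see `inducedFun_Phi`; the value is `0` if there is none. -/
def inducedFun (F : ℂ → Complexification A) (x : A) : A :=
  if h : ∃ p : A × ℂ, p.1 ∈ imaginaryUnits A ∧ x = Phi p.1 p.2 then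
    (F h.choose.2).re + h.choose.1 * (F h.choose.2).im
  else 0

/-- The stem function `z ↦ (z - y)ⁿ`. -/
def stemPow (y : A) (n : ℕ) (z : ℂ) : Complexification A :=
  Complexification.pow ⟨z.re • (1 : A) - y, z.im • (1 : A)⟩ n

theorem isStemOn_stemPow (D : Set ℂ) (y : A) (n : ℕ) : IsStemOn D (stemPow y n) := by
  intro z _
  rw [stemPow, stemPow, Complexification.conj_pow]
  simp [Complexification.conj]

/-- The slice power `(x - y)^{·n}`: the value at `x` of the slice function induced by
`z ↦ (z - y)ⁿ`. -/
def slicePow (y : A) (n : ℕ) (x : A) : A := inducedFun (stemPow y n) x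

/-- `f` is a slice function on `O_D`: it is induced there by some stem function on `D`. -/
def IsSliceOn (D : Set ℂ) (f : A → A) : Prop :=
  ∃ F : ℂ → Complexification A, IsStemOn D F ∧ Set.EqOn f (inducedFun F) (circularSet A D)

end Slice

section WellDefined

variable {A : Type*} [NonAssocRing A] [Module ℝ A] [StarRing A] [StarModule ℝ A]
  [SMulCommClass ℝ A A] [IsScalarTower ℝ A A]

theorem star_eq_neg {J : A} (hJ : J ∈ imaginaryUnits A) : star J = -J := by
  rcases subsingleton_or_nontrivial A with hA | hA
  · exact Subsingleton.elim _ _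
  have key : ∀ r : ℝ, J ≠ r • (1 : A) := by
    rintro r rfl
    have h := hJ.2
    rw [smul_mul_assoc, one_mul, smul_smul, ← sub_eq_zero, sub_neg_eq_add] at h
    have h2 : (r * r + 1) • (1 : A) = 0 := by rw [add_smul, one_smul, h]
    rcases smul_eq_zero.1 h2 with h3 | h3
    · nlinarith [mul_self_nonneg r]
    · exact one_ne_zero h3
  rcases hJ.1 with ⟨r, hr⟩ | ⟨t, n, ht, hn, -⟩
  · exact absurd hr (key r)
  have hs : star J = t • (1 : A) - J := by rw [← ht]; abel
  have h0 : t • J = (n - 1) • (1 : A) := by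
    rw [hs, mul_sub, mul_smul_comm, mul_one, hJ.2] at hn
    rw [sub_smul, one_smul, ← hn]; abel
  have ht0 : t = 0 := by
    by_contra hne
    refine key (t⁻¹ * (n - 1)) ?_
    rw [mul_smul, ← h0, smul_smul, inv_mul_cancel₀ hne, one_smul]
  rw [hs, ht0, zero_smul, zero_sub]

/-- The value of `I(F)` at `Φ_J(z)` does not depend on `J` and `z`. -/
theorem inducedFun_Phi {D : Set ℂ} {F : ℂ → Complexification A} (hF : IsStemOn D F)
    {J : A} (hJ : J ∈ imaginaryUnits A) {z : ℂ} (hz : z ∈ D) :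
    inducedFun F (Phi J z) = (F z).re + J * (F z).im := by
  rcases subsingleton_or_nontrivial A with hA | hA
  · exact Subsingleton.elim _ _
  have h : ∃ p : A × ℂ, p.1 ∈ imaginaryUnits A ∧ Phi J z = Phi p.1 p.2 := ⟨(J, z), hJ, rfl⟩
  rw [inducedFun, dif_pos h]
  obtain ⟨hI, hIw⟩ := h.choose_spec
  generalize h.choose = p at hI hIw
  obtain ⟨I, w⟩ := p
  simp only [Phi] at hI hIw ⊢
  have hst := congrArg star hIw
  simp only [star_add, star_smul, star_one, star_trivial, star_eq_neg hI, star_eq_neg hJ] at hst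
  have two : ∀ a : A, a + a = 0 → a = 0 := fun a ha => by
    have : (2 : ℝ) • a = 0 := by rw [two_smul, ha]
    simpa using this
  have hre : (z.re - w.re) • (1 : A) = 0 := by
    apply two
    have := congrArg₂ (· + ·) hIw hst
    simp only [smul_neg] at this
    rw [sub_smul, ← sub_eq_zero.2 this]; abel
  have hre' : z.re = w.re := by
    rcases smul_eq_zero.1 hre with h | h
    · linarith
    · exact absurd h one_ne_zero
  have him : z.im • J = w.im • I := by
    rw [hre'] at hIw; exact add_left_cancel hIw
  have hsq : (w.im * w.im - z.im * z.im) • (1 : A) = 0 := by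
    have := congrArg₂ (· * ·) him him
    simp only [smul_mul_assoc, mul_smul_comm, hJ.2, hI.2, smul_smul, smul_neg] at this
    rw [sub_smul, ← sub_eq_zero.2 this]; abel
  have hsq' : w.im * w.im = z.im * z.im := by
    rcases smul_eq_zero.1 hsq with h | h
    · linarith
    · exact absurd h one_ne_zero
  by_cases h0 : z.im = 0
  · have hw0 : w.im = 0 := by rw [h0] at hsq'; simpa using hsq'
    have hzw : w = z := Complex.ext hre'.symm (by rw [h0, hw0])
    have hc : starRingEnd ℂ z = z := Complex.conj_eq_iff_im.2 h0
    have hF0 : (F z).im = 0 := by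
      have := congrArg Complexification.im (hF z hz)
      rw [hc, Complexification.conj_im] at this
      apply two; nth_rewrite 1 [this]; abel
    rw [hzw, hF0, mul_zero, mul_zero]
  · rcases mul_self_eq_mul_self_iff.1 hsq' with h1 | h1
    · have hzw : w = z := Complex.ext hre'.symm h1
      have hIJ : I = J := by
        rw [h1] at him; exact (smul_right_injective A h0 him).symm
      rw [hzw, hIJ]
    · have hzw : w = starRingEnd ℂ z := Complex.ext (by simp [hre']) (by simp [h1])
      have hIJ : I = -J := by
        rw [h1, neg_smul, ← smul_neg] at him
        rw [smul_right_injective A h0 him, neg_neg]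
      rw [hzw, hIJ, hF z hz]; simp

theorem slicePow_Phi (y : A) (n : ℕ) {J : A} (hJ : J ∈ imaginaryUnits A) (z : ℂ) :
    slicePow y n (Phi J z) = (stemPow y n z).re + J * (stemPow y n z).im :=
  inducedFun_Phi (isStemOn_stemPow Set.univ y n) hJ (Set.mem_univ z)

end WellDefined

section Analysis

variable {A : Type*} [NormedNonAssocRing A] [NormedSpace ℝ A] [StarRing A]

/-- `∂F/∂z̄ = (∂F/∂α + i ∂F/∂β) / 2`, in components. -/
def dbar (F : ℂ → Complexification A) (z : ℂ) : Complexification A where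
  re := (1 / 2 : ℝ) •
    (fderiv ℝ (fun w => (F w).re) z 1 - fderiv ℝ (fun w => (F w).im) z Complex.I)
  im := (1 / 2 : ℝ) •
    (fderiv ℝ (fun w => (F w).im) z 1 + fderiv ℝ (fun w => (F w).re) z Complex.I)

/-- `f` is slice regular on `O_D`: it is induced by a stem function `F` of class `C¹` on `D`
such that `∂f/∂xᶜ = I(∂F/∂z̄)` vanishes on `O_D`. -/
def IsSliceRegularOn (D : Set ℂ) (f : A → A) : Prop :=
  ∃ F : ℂ → Complexification A, IsStemOn D F ∧
    ContDiffOn ℝ 1 (fun z => (F z).re) D ∧ ContDiffOn ℝ 1 (fun z => (F z).im) D ∧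
    Set.EqOn f (inducedFun F) (circularSet A D) ∧
    ∀ x ∈ circularSet A D, inducedFun (dbar F) x = 0

open Classical in
/-- The distance `σ_A` on the quadratic cone: the first case is the one in which `x` and `y` lie on
a common slice `ℂ_J`. -/
def sigmaDist (x y : A) : ℝ :=
  if ∃ J ∈ imaginaryUnits A, y ∈ slice J ∧ x ∈ slice J then ‖x - y‖
  else √(‖rePart x - rePart y‖ ^ 2 + (‖imPart x‖ + ‖imPart y‖) ^ 2)

/-- The `σ_A`-ball of `Q_A` with centre `y` and radius `r`. -/
def sigmaBall (y : A) (r : ℝ) : Set A := {x | x ∈ quadraticCone A ∧ sigmaDist x y < r}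

/-- `f` is `σ_A`-analytic on `U`: every `y ∈ U` is the centre of a nonempty `σ_A`-ball contained in
`U` at all points `x` of which `f(x)` is the sum of a series `∑ₙ (x - y)^{·n} aₙ`. -/
def IsSigmaAnalyticOn (U : Set A) (f : A → A) : Prop :=
  ∀ y ∈ U, ∃ r : ℝ, 0 < r ∧ sigmaBall y r ⊆ U ∧ ∃ a : ℕ → A, ∀ x ∈ sigmaBall y r,
    Tendsto (fun N : ℕ => ∑ n ∈ Finset.range N, slicePow y n x * a n) atTop (𝓝 (f x))

end Analysis

end SliceAnalysis

end

open SliceAnalysis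

/-!
# Slice regular functions are the `σ_A`-analytic slice functions

The problem is reduced to one complex variable on each slice `ℂ_J`. Left multiplication by
`J ∈ S_A` is a complex structure on `A`, because alternativity gives `J (J a) = -a`. On `ℂ_J` the
slice power `(x - y)^{·n}` with `y ∈ ℂ_J` is the ordinary power (`slicePow_eq_Phi`), so on the
slice of its centre a series `∑ (x - y)^{·n} aₙ` is an ordinary power series in one complex variable
for that structure. Hence

* a slice function is slice regular if and only if `z ↦ f (Φ_J z)` is holomorphic for the
  structure `J`, for every `J` (`IsSliceRegularOn.isLeftHolomorphicOn`,
  `IsSliceOn.isSliceRegularOn`): on `ℂ_J` and `ℂ_{-J}` the Cauchy–Riemann equations for `f` read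
  `G₁ ± J G₂ = 0`, where `G₁ + i G₂ = ∂F/∂z̄`;
* a `σ_A`-analytic function is holomorphic on every slice, and a slice function holomorphic on
  every slice is `σ_A`-analytic (`IsSigmaAnalyticOn.isLeftHolomorphicOn`,
  `IsSliceOn.isSigmaAnalyticOn`). In the second claim associativity is never needed between two
  different units and a coefficient: a small `σ_A`-ball about a non-real point stays in one slice,
  and about a real point the two components of `(z - y)ⁿ` are real.

It remains to see that `σ_A`-analyticity implies that `f` is a slice function if `D` contains a
real point `p` (`IsSigmaAnalyticOn.isSliceOn`). The values of `f` on one slice `ℂ_J` define a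
holomorphic stem function (`stemOfSlice`, `contDiffOn_stemOfSlice`); the slice function that it
induces agrees with `f` near `p` on each other slice, by the power series at `p`
(`tendsto_stemOfSlice`), hence on the whole slice by the identity principle, since `D` is connected
(`isPreconnected_of_isConnected_circularSet`).

The norm of `A` is only controlled on the quadratic cone, so the complex analysis is carried
out in complex coordinates (`exists_complexCoordinates`), all norms on `A` being equivalent.
-/

namespace SliceAnalysis

/-! ### Slices of the quadratic cone -/

section Cone

theorem mul_mul_eq_neg {A : Type*} [NonAssocRing A] [IsAlternative A] {J : A} (hJ : J * J = -1)
    (a : A) : J * (J * a) = -a := by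
  rw [IsAlternative.left_alternative, hJ, neg_mul, one_mul]

variable {A : Type*} [NonAssocRing A] [Module ℝ A]

theorem Phi_ofReal (J : A) (r : ℝ) : Phi J (r : ℂ) = r • (1 : A) := by simp [Phi]

theorem Phi_add (J : A) (z w : ℂ) : Phi J (z + w) = Phi J z + Phi J w := by
  simp only [Phi, Complex.add_re, Complex.add_im, add_smul]; abel

theorem Phi_sub (J : A) (z w : ℂ) : Phi J (z - w) = Phi J z - Phi J w := by
  simp only [Phi, Complex.sub_re, Complex.sub_im, sub_smul]; abel

theorem Phi_smul (J : A) (r : ℝ) (z : ℂ) : Phi J (r • z) = r • Phi J z := by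
  simp [Phi, smul_add, smul_smul]

theorem Phi_mem_slice (J : A) (z : ℂ) : Phi J z ∈ slice J := ⟨z.re, z.im, rfl⟩

theorem Phi_neg (J : A) (z : ℂ) : Phi (-J) z = Phi J (starRingEnd ℂ z) := by simp [Phi]

theorem neg_mem_imaginaryUnits [StarRing A] {J : A} (hJ : J ∈ imaginaryUnits A) :
    -J ∈ imaginaryUnits A := by
  refine ⟨?_, by rw [neg_mul_neg, hJ.2]⟩
  rcases hJ.1 with ⟨r, rfl⟩ | ⟨t, n, ht, hn, h⟩
  · exact Or.inl ⟨-r, (neg_smul _ _).symm⟩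
  · refine Or.inr ⟨-t, n, ?_, ?_, by rwa [neg_sq]⟩
    · rw [star_neg, neg_smul, ← ht]; abel
    · rw [star_neg, neg_mul_neg, hn]

variable [SMulCommClass ℝ A A] [IsScalarTower ℝ A A]

theorem Phi_mul_Phi {J : A} (hJ : J * J = -1) (z w : ℂ) :
    Phi J z * Phi J w = Phi J (z * w) := by
  simp only [Phi, mul_add, add_mul, smul_mul_assoc, mul_smul_comm, one_mul, mul_one, hJ,
    Complex.mul_re, Complex.mul_im]
  module

variable [StarRing A]

theorem Phi_mem_quadraticCone [StarModule ℝ A] {J : A} (hJ : J ∈ imaginaryUnits A) (z : ℂ) :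
    Phi J z ∈ quadraticCone A := by
  by_cases hz : z.im = 0
  · exact Or.inl ⟨z.re, by simp [Phi, hz]⟩
  have hs : star (Phi J z) = Phi J (starRingEnd ℂ z) := by simp [Phi, star_eq_neg hJ]
  refine Or.inr ⟨2 * z.re, z.re ^ 2 + z.im ^ 2, ?_, ?_, ?_⟩
  · rw [hs, ← Phi_add, Complex.add_conj, Phi_ofReal]
  · rw [hs, Phi_mul_Phi hJ.2, Complex.mul_conj, Phi_ofReal, Complex.normSq_apply]
    congr 1; ring
  · have : 0 < z.im ^ 2 := by positivity
    nlinarith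

/-- A non-real point `x` of the quadratic cone satisfies `x² - t x + n = 0` with negative
discriminant, so completing the square yields a square root of `-1`. -/
theorem exists_eq_Phi [StarModule ℝ A] (hne : (imaginaryUnits A).Nonempty) {x : A}
    (hx : x ∈ quadraticCone A) : ∃ J ∈ imaginaryUnits A, ∃ z : ℂ, x = Phi J z := by
  rcases hx with ⟨r, rfl⟩ | ⟨t, n, ht, hn, h⟩
  · obtain ⟨J, hJ⟩ := hne
    exact ⟨J, hJ, r, (Phi_ofReal J r).symm⟩
  have hpos : 0 < n - t ^ 2 / 4 := by linarith
  set s := √(n - t ^ 2 / 4) with hs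
  have hs0 : s ≠ 0 := (Real.sqrt_pos.2 hpos).ne'
  have hs2 : s * s = n - t ^ 2 / 4 := Real.mul_self_sqrt hpos.le
  have hst : star x = t • (1 : A) - x := by rw [← ht]; abel
  have hxx : x * x = t • x - n • (1 : A) := by
    rw [hst, mul_sub, mul_smul_comm, mul_one] at hn
    rw [← hn]; abel
  set J : A := s⁻¹ • (x - (t / 2) • (1 : A)) with hJdef
  have hJJ : J * J = -1 := by
    have h1 : (x - (t / 2) • (1 : A)) * (x - (t / 2) • (1 : A)) = (-(s * s)) • (1 : A) := by
      simp only [mul_sub, sub_mul, smul_mul_assoc, mul_smul_comm, one_mul, mul_one, hxx]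
      rw [hs2]
      module
    rw [hJdef, smul_mul_assoc, mul_smul_comm, h1, smul_smul, smul_smul]
    have : s⁻¹ * s⁻¹ * -(s * s) = -1 := by field_simp
    rw [this, neg_smul, one_smul]
  have hsJ : star J = -J := by
    rw [hJdef, star_smul, star_sub, star_smul, star_one, hst, star_trivial, star_trivial]
    module
  refine ⟨J, ⟨Or.inr ⟨0, 1, ?_, ?_, by norm_num⟩, hJJ⟩, ⟨t / 2, s⟩, ?_⟩
  · rw [hsJ]; simp
  · rw [hsJ, mul_neg, hJJ]; simp
  · simp only [Phi, hJdef, smul_smul, mul_inv_cancel₀ hs0, one_smul]; abel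

/-- On the slice through its centre, the slice power `(x - y)^{·n}` is the ordinary power. -/
theorem slicePow_eq_Phi [StarModule ℝ A] {J : A} (hJ : J ∈ imaginaryUnits A) (w z : ℂ) (n : ℕ) :
    slicePow (Phi J w) n (Phi J z) = Phi J ((z - w) ^ n) := by
  rw [slicePow_Phi _ _ hJ]
  -- The two components of `(z - y)ⁿ` stay in the commutative subalgebra `ℂ_J`.
  obtain ⟨p, q, hp, hq, hpq⟩ : ∃ p q : ℂ, (stemPow (Phi J w) n z).re = Phi J p ∧
      (stemPow (Phi J w) n z).im = Phi J q ∧ p + Complex.I * q = (z - w) ^ n := by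
    induction n with
    | zero =>
      exact ⟨1, 0, by simp [stemPow, Complexification.pow, Phi],
        by simp [stemPow, Complexification.pow, Phi], by simp⟩
    | succ n ih =>
      obtain ⟨p, q, hp, hq, hpq⟩ := ih
      rw [stemPow] at hp hq
      refine ⟨p * (z.re - w) - q * z.im, p * z.im + q * (z.re - w), ?_, ?_, ?_⟩
      · rw [stemPow, Complexification.pow, Complexification.mul_re, hp, hq]
        simp only [Phi_sub, ← Phi_mul_Phi hJ.2, Phi_ofReal]
      · rw [stemPow, Complexification.pow, Complexification.mul_im, hp, hq]
        simp only [Phi_sub, Phi_add, ← Phi_mul_Phi hJ.2, Phi_ofReal]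
      · rw [pow_succ, ← hpq]
        have hz : z - w = (z.re - w) + Complex.I * z.im := by
          nth_rewrite 1 [← Complex.re_add_im z]; ring
        rw [hz]
        linear_combination (-q * z.im) * Complex.I_mul_I
  have hJI : J = Phi J Complex.I := by simp [Phi]
  rw [hp, hq, ← hpq, Phi_add, ← Phi_mul_Phi hJ.2, ← hJI]

variable [StarModule ℝ A]

theorem rePart_Phi {J : A} (hJ : J ∈ imaginaryUnits A) (z : ℂ) :
    rePart (Phi J z) = z.re • (1 : A) := by
  simp only [rePart, Phi, star_add, star_smul, star_one, star_trivial, star_eq_neg hJ]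
  module

theorem imPart_Phi {J : A} (hJ : J ∈ imaginaryUnits A) (z : ℂ) :
    imPart (Phi J z) = z.im • J := by
  simp only [imPart, Phi, star_add, star_smul, star_one, star_trivial, star_eq_neg hJ]
  module

/-- A non-real point lies on only one slice. -/
theorem slice_subset_of_Phi_mem {J K : A} (hJ : J ∈ imaginaryUnits A)
    (hK : K ∈ imaginaryUnits A) {w : ℂ} (hw : w.im ≠ 0) (h : Phi J w ∈ slice K) :
    slice K ⊆ slice J := by
  obtain ⟨α, β, hαβ⟩ := h
  have him : w.im • J = β • K := by
    have : imPart (Phi J w) = imPart (Phi K ⟨α, β⟩) := congrArg imPart hαβ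
    rwa [imPart_Phi hJ, imPart_Phi hK] at this
  rintro x ⟨γ, δ, rfl⟩
  by_cases hβ : β = 0
  · -- `w.im • J = 0` forces `J = 0`, hence `1 = 0`.
    have hJ0 : J = 0 := by
      rw [hβ, zero_smul] at him
      exact (smul_eq_zero.1 him).resolve_left hw
    have h1 : (1 : A) = 0 := by
      have := hJ.2; rw [hJ0, mul_zero] at this; exact neg_eq_zero.1 this.symm
    refine ⟨0, 0, ?_⟩
    rw [← mul_one (γ • (1 : A) + δ • K), h1]; simp
  · refine ⟨γ, δ * (β⁻¹ * w.im), ?_⟩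
    rw [mul_smul, mul_smul, him, smul_smul β⁻¹, inv_mul_cancel₀ hβ, one_smul]

theorem Phi_mem_circularSet {D : Set ℂ} {J : A} (hJ : J ∈ imaginaryUnits A) {z : ℂ}
    (hz : z ∈ D) : Phi J z ∈ circularSet A D :=
  ⟨Phi_mem_quadraticCone hJ z, z, hz, J, hJ, rfl⟩

end Cone

/-! ### Balls of the distance `σ_A` -/

section Balls

variable {A : Type*} [NormedNonAssocRing A] [NormedSpace ℝ A]
    [SMulCommClass ℝ A A] [IsScalarTower ℝ A A] [StarRing A] [StarModule ℝ A]

/-- The norm of `A` restricts to the modulus on each slice. -/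
theorem norm_Phi [Nontrivial A]
    (hnorm : ∀ x ∈ quadraticCone A, x * star x = (‖x‖ ^ 2) • (1 : A))
    {J : A} (hJ : J ∈ imaginaryUnits A) (z : ℂ) : ‖Phi J z‖ = ‖z‖ := by
  have h := hnorm _ (Phi_mem_quadraticCone hJ z)
  have hs : star (Phi J z) = Phi J (starRingEnd ℂ z) := by simp [Phi, star_eq_neg hJ]
  rw [hs, Phi_mul_Phi hJ.2, Complex.mul_conj, Phi_ofReal, Complex.normSq_eq_norm_sq] at h
  have h2 := smul_left_injective ℝ (one_ne_zero (α := A)) h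
  exact ((sq_eq_sq₀ (norm_nonneg _) (norm_nonneg _)).1 h2).symm

theorem sigmaDist_Phi [Nontrivial A]
    (hnorm : ∀ x ∈ quadraticCone A, x * star x = (‖x‖ ^ 2) • (1 : A))
    {J : A} (hJ : J ∈ imaginaryUnits A) (z w : ℂ) :
    sigmaDist (Phi J z) (Phi J w) = ‖z - w‖ := by
  rw [sigmaDist, if_pos ⟨J, hJ, Phi_mem_slice J w, Phi_mem_slice J z⟩, ← Phi_sub,
    norm_Phi hnorm hJ]

/-- A `σ_A`-ball about a non-real point that is too small to reach the real axis is a disc in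
the slice of its centre. -/
theorem exists_of_mem_sigmaBall [Nontrivial A]
    (hnorm : ∀ x ∈ quadraticCone A, x * star x = (‖x‖ ^ 2) • (1 : A))
    {J : A} (hJ : J ∈ imaginaryUnits A) {w : ℂ} (hw : w.im ≠ 0) {r : ℝ} (hr : r ≤ |w.im|)
    {x : A} (hx : x ∈ sigmaBall (Phi J w) r) : ∃ z ∈ Metric.ball w r, x = Phi J z := by
  obtain ⟨-, hd⟩ := hx
  by_cases h : ∃ K ∈ imaginaryUnits A, Phi J w ∈ slice K ∧ x ∈ slice K
  · obtain ⟨K, hK, hyK, hxK⟩ := h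
    obtain ⟨α, β, rfl⟩ := slice_subset_of_Phi_mem hJ hK hw hyK hxK
    refine ⟨⟨α, β⟩, ?_, rfl⟩
    have := sigmaDist_Phi hnorm hJ ⟨α, β⟩ w
    rw [mem_ball_iff_norm, ← this]
    exact hd
  · have hJ1 : ‖J‖ = 1 := by
      have := norm_Phi hnorm hJ Complex.I
      simpa [Phi] using this
    rw [sigmaDist, if_neg h, imPart_Phi hJ, norm_smul, hJ1, mul_one, Real.norm_eq_abs] at hd
    refine absurd (hd.trans_le hr) (not_lt.2 (Real.le_sqrt_of_sq_le ?_))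
    have h1 : |w.im| ^ 2 ≤ (‖imPart x‖ + |w.im|) ^ 2 := by
      gcongr; linarith [norm_nonneg (imPart x)]
    exact h1.trans (le_add_of_nonneg_left (sq_nonneg _))

/-- A `σ_A`-ball about a real point is a circular set. -/
theorem exists_of_mem_sigmaBall_real [Nontrivial A]
    (hnorm : ∀ x ∈ quadraticCone A, x * star x = (‖x‖ ^ 2) • (1 : A))
    (hne : (imaginaryUnits A).Nonempty) {p r : ℝ}
    {x : A} (hx : x ∈ sigmaBall (p • (1 : A)) r) :
    ∃ J ∈ imaginaryUnits A, ∃ z ∈ Metric.ball (p : ℂ) r, x = Phi J z := by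
  obtain ⟨hQ, hd⟩ := hx
  obtain ⟨J, hJ, z, rfl⟩ := exists_eq_Phi hne hQ
  refine ⟨J, hJ, z, ?_, rfl⟩
  rwa [← Phi_ofReal J, sigmaDist_Phi hnorm hJ, ← mem_ball_iff_norm] at hd

theorem Phi_mem_sigmaBall [Nontrivial A]
    (hnorm : ∀ x ∈ quadraticCone A, x * star x = (‖x‖ ^ 2) • (1 : A))
    {J : A} (hJ : J ∈ imaginaryUnits A) {w z : ℂ} {r : ℝ} (hz : z ∈ Metric.ball w r) :
    Phi J z ∈ sigmaBall (Phi J w) r :=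
  ⟨Phi_mem_quadraticCone hJ z, by rwa [sigmaDist_Phi hnorm hJ, ← mem_ball_iff_norm]⟩

end Balls

/-! ### Pointwise convergent power series -/

section PowerSeries

/-- Pointwise convergence of the partial sums of a power series on a disc already makes the sum
holomorphic there: the terms are bounded, so the radius of convergence is at least that of the
disc. -/
theorem differentiableOn_of_tendsto_sum_pow_smul {E : Type*} [NormedAddCommGroup E]
    [NormedSpace ℂ E] [CompleteSpace E] {g : ℂ → E} {w : ℂ} {r : ℝ} (hr : 0 < r) (b : ℕ → E)
    (h : ∀ z ∈ Metric.ball w r, Tendsto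
      (fun N : ℕ => ∑ n ∈ Finset.range N, (z - w) ^ n • b n) atTop (𝓝 (g z))) :
    DifferentiableOn ℂ g (Metric.ball w r) := by
  let p : FormalMultilinearSeries ℂ ℂ E :=
    fun n => ContinuousMultilinearMap.mkPiRing ℂ (Fin n) (b n)
  have hp : ∀ n (c : ℂ), (p n fun _ => c) = c ^ n • b n := fun n c => by
    simp [p, ContinuousMultilinearMap.mkPiRing_apply]
  have hrad : ENNReal.ofReal r ≤ p.radius := by
    refine ENNReal.le_of_forall_nnreal_lt fun ρ hρ => ?_
    have hρ' : (ρ : ℝ) < r := by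
      rwa [← ENNReal.ofReal_coe_nnreal, ENNReal.ofReal_lt_ofReal_iff hr] at hρ
    have hz : w + (ρ : ℂ) ∈ Metric.ball w r := by simpa using hρ'
    have ht := h _ hz
    -- The terms are differences of consecutive partial sums, hence tend to zero.
    have h0 := ((ht.comp (tendsto_add_atTop_nat 1)).sub ht).norm
    simp only [Function.comp_def, Finset.sum_range_succ, add_sub_cancel_left, sub_self,
      norm_zero] at h0
    refine p.le_radius_of_tendsto (l := 0) (h0.congr fun n => ?_)
    rw [norm_smul, norm_pow, ContinuousMultilinearMap.norm_mkPiRing, mul_comm]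
    simp
  have hr' : 0 < ENNReal.ofReal r := ENNReal.ofReal_pos.2 hr
  have hps : HasFPowerSeriesOnBall g p w (ENNReal.ofReal r) := by
    refine ⟨hrad, hr', fun {y} hy => ?_⟩
    have hs := p.hasSum (Metric.eball_subset_eball hrad hy)
    have hy' : w + y ∈ Metric.ball w r := by
      rw [Metric.eball_ofReal] at hy
      simpa using hy
    have ht := h _ hy'
    simp only [add_sub_cancel_left, ← hp] at ht
    rwa [tendsto_nhds_unique ht hs.tendsto_sum_nat]
  have := hps.differentiableOn
  rwa [Metric.eball_ofReal] at this

end PowerSeries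

/-! ### Holomorphy for left multiplication by an imaginary unit -/

section LeftHolomorphic

variable {A : Type*} [NormedNonAssocRing A] [NormedSpace ℝ A]

/-- `g : ℂ → A` is holomorphic on `D` for the complex structure `a ↦ J a` of `A`, that is,
it is real differentiable and satisfies the Cauchy–Riemann equation `∂g/∂β = J ∂g/∂α`. -/
def IsLeftHolomorphicOn (J : A) (D : Set ℂ) (g : ℂ → A) : Prop :=
  ∀ z ∈ D, DifferentiableAt ℝ g z ∧ fderiv ℝ g z Complex.I = J * fderiv ℝ g z 1

theorem IsLeftHolomorphicOn.mono {J : A} {D E : Set ℂ} {g : ℂ → A}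
    (hg : IsLeftHolomorphicOn J D g) (h : E ⊆ D) : IsLeftHolomorphicOn J E g :=
  fun z hz => hg z (h hz)

theorem IsLeftHolomorphicOn.congr {J : A} {D : Set ℂ} {g h : ℂ → A} (hD : IsOpen D)
    (hg : IsLeftHolomorphicOn J D g) (hgh : Set.EqOn h g D) : IsLeftHolomorphicOn J D h := by
  intro z hz
  have hev : h =ᶠ[𝓝 z] g := hgh.eventuallyEq_of_mem (hD.mem_nhds hz)
  rw [hev.fderiv_eq, hev.differentiableAt_iff]
  exact hg z hz

theorem isLeftHolomorphicOn_iff {J : A} {D : Set ℂ} {g : ℂ → A} {m : ℕ}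
    {e : A ≃L[ℝ] (Fin m → ℂ)} (hD : IsOpen D)
    (he : ∀ (c : ℂ) (a : A), e (Phi J c * a) = c • e a) :
    IsLeftHolomorphicOn J D g ↔ DifferentiableOn ℂ (fun z => e (g z)) D := by
  have hJI : ∀ a, e (J * a) = Complex.I • e a := fun a => by
    rw [← he]; simp [Phi]
  have key : ∀ z, (DifferentiableAt ℝ g z ∧ fderiv ℝ g z Complex.I = J * fderiv ℝ g z 1) ↔
      DifferentiableAt ℂ (fun z => e (g z)) z := fun z => by
    have hf : fderiv ℝ (fun z => e (g z)) z = (e : A →L[ℝ] (Fin m → ℂ)).comp (fderiv ℝ g z) :=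
      e.comp_fderiv
    rw [differentiableAt_complex_iff_differentiableAt_real, hf]
    refine and_congr e.comp_differentiableAt_iff.symm ?_
    simp only [ContinuousLinearMap.comp_apply, ContinuousLinearEquiv.coe_coe, ← hJI]
    exact e.injective.eq_iff.symm
  exact ⟨fun h z hz => ((key z).1 (h z hz)).differentiableWithinAt,
    fun h z hz => (key z).2 (h.differentiableAt (hD.mem_nhds hz))⟩

variable [SMulCommClass ℝ A A] [IsScalarTower ℝ A A] [FiniteDimensional ℝ A]

variable (A) in
/-- The multiplication of `A` as a continuous bilinear map. -/
noncomputable def mulCLM : A →L[ℝ] A →L[ℝ] A :=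
  LinearMap.toContinuousLinearMap
    (LinearMap.toContinuousLinearMap.toLinearMap ∘ₗ LinearMap.mul ℝ A)

@[simp] theorem mulCLM_apply (a b : A) : mulCLM A a b = a * b := rfl

variable [IsAlternative A]

/-- Complex coordinates for the complex structure `a ↦ J a`. They replace the given norm, which
need not be compatible with that structure, by the norm of `ℂᵐ`. -/
theorem exists_complexCoordinates {J : A} (hJ : J * J = -1) :
    ∃ (m : ℕ) (e : A ≃L[ℝ] (Fin m → ℂ)), ∀ (c : ℂ) (a : A), e (Phi J c * a) = c • e a := by
  let φ : ℂ →ₐ[ℝ] Module.End ℝ A := Complex.liftAux (LinearMap.mulLeft ℝ J) (by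
    ext a; simpa using mul_mul_eq_neg hJ a)
  have hφ : ∀ (c : ℂ) (a : A), φ c a = Phi J c * a := fun c a => by
    simp [φ, Complex.liftAux_apply, Phi, add_mul, smul_mul_assoc]
  let _ : Module ℂ A := Module.compHom A φ.toRingHom
  have hsmul : ∀ (c : ℂ) (a : A), c • a = Phi J c * a := hφ
  have : IsScalarTower ℝ ℂ A := ⟨fun r c a => by
    rw [hsmul, hsmul, Phi_smul, smul_mul_assoc]⟩
  have : FiniteDimensional ℂ A := FiniteDimensional.right ℝ ℂ A
  let e := (Module.finBasis ℂ A).equivFun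
  refine ⟨_, (e.restrictScalars ℝ).toContinuousLinearEquiv, fun c a => ?_⟩
  rw [← hsmul]
  exact map_smul e c a

theorem IsLeftHolomorphicOn.contDiffOn {J : A} (hJ : J * J = -1) {D : Set ℂ} {g : ℂ → A}
    (hD : IsOpen D) (hg : IsLeftHolomorphicOn J D g) : ContDiffOn ℝ 1 g D := by
  obtain ⟨m, e, he⟩ := exists_complexCoordinates hJ
  have h := ((isLeftHolomorphicOn_iff hD he).1 hg).contDiffOn (n := 1) hD
  have h2 := e.symm.contDiff (n := 1).comp_contDiffOn (h.restrict_scalars ℝ)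
  simpa [Function.comp_def] using h2

theorem IsLeftHolomorphicOn.exists_tendsto {J : A} (hJ : J * J = -1) {g : ℂ → A} {w : ℂ} {r : ℝ}
    (hg : IsLeftHolomorphicOn J (Metric.ball w r) g) :
    ∃ a : ℕ → A, ∀ z ∈ Metric.ball w r, Tendsto
      (fun N : ℕ => ∑ n ∈ Finset.range N, Phi J ((z - w) ^ n) * a n) atTop (𝓝 (g z)) := by
  obtain ⟨m, e, he⟩ := exists_complexCoordinates hJ
  have h := (isLeftHolomorphicOn_iff Metric.isOpen_ball he).1 hg
  refine ⟨fun n => e.symm ((n.factorial : ℂ)⁻¹ • iteratedDeriv n (fun z => e (g z)) w),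
    fun z hz => ?_⟩
  have hs := (Complex.hasSum_taylorSeries_on_ball h hz).tendsto_sum_nat
  have hs' := (e.symm.continuous.tendsto _).comp hs
  rw [e.symm_apply_apply] at hs'
  refine hs'.congr fun N => ?_
  rw [Function.comp_apply, map_sum]
  refine Finset.sum_congr rfl fun n _ => e.injective ?_
  rw [he, e.apply_symm_apply, e.apply_symm_apply, smul_comm]

theorem isLeftHolomorphicOn_of_tendsto {J : A} (hJ : J * J = -1) {D : Set ℂ} (hD : IsOpen D)
    {g : ℂ → A} (h : ∀ w ∈ D, ∃ r > 0, ∃ a : ℕ → A, ∀ z ∈ Metric.ball w r, Tendsto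
      (fun N : ℕ => ∑ n ∈ Finset.range N, Phi J ((z - w) ^ n) * a n) atTop (𝓝 (g z))) :
    IsLeftHolomorphicOn J D g := by
  obtain ⟨m, e, he⟩ := exists_complexCoordinates hJ
  refine (isLeftHolomorphicOn_iff hD he).2 fun w hw => ?_
  obtain ⟨r, hr, a, ha⟩ := h w hw
  refine ((differentiableOn_of_tendsto_sum_pow_smul hr (fun n => e (a n)) fun z hz =>
    ?_).differentiableAt (Metric.ball_mem_nhds w hr)).differentiableWithinAt
  refine ((e.continuous.tendsto _).comp (ha z hz)).congr fun N => ?_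
  rw [Function.comp_apply, map_sum]
  exact Finset.sum_congr rfl fun n _ => he _ _

theorem IsLeftHolomorphicOn.eqOn_of_eventuallyEq {J : A} (hJ : J * J = -1) {D : Set ℂ}
    (hD : IsOpen D) (hDc : IsPreconnected D) {g h : ℂ → A} (hg : IsLeftHolomorphicOn J D g)
    (hh : IsLeftHolomorphicOn J D h) {p : ℂ} (hp : p ∈ D) (hgh : g =ᶠ[𝓝 p] h) :
    Set.EqOn g h D := by
  obtain ⟨m, e, he⟩ := exists_complexCoordinates hJ
  have h1 := ((isLeftHolomorphicOn_iff hD he).1 hg).analyticOnNhd hD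
  have h2 := ((isLeftHolomorphicOn_iff hD he).1 hh).analyticOnNhd hD
  have := h1.eqOn_of_preconnected_of_eventuallyEq h2 hDc hp (hgh.fun_comp e)
  exact fun z hz => e.injective (this hz)

end LeftHolomorphic

/-! ### The Cauchy–Riemann operator on stem functions -/

section StemFunctions

variable {A : Type*} [NormedNonAssocRing A] [NormedSpace ℝ A]

theorem isStemOn_dbar {D : Set ℂ} (hD : IsOpen D)
    {F : ℂ → Complexification A} (hF : IsStemOn D F) : IsStemOn D (dbar F) := by
  intro z hz
  have hre : (fun w => (F (starRingEnd ℂ w)).re) =ᶠ[𝓝 z] fun w => (F w).re := by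
    filter_upwards [hD.mem_nhds hz] with w hw
    rw [hF w hw, Complexification.conj_re]
  have him : (fun w => (F (starRingEnd ℂ w)).im) =ᶠ[𝓝 z] fun w => -(F w).im := by
    filter_upwards [hD.mem_nhds hz] with w hw
    rw [hF w hw, Complexification.conj_im]
  have chain : ∀ (g : ℂ → A) (v : ℂ), fderiv ℝ (fun w => g (starRingEnd ℂ w)) z v =
      fderiv ℝ g (starRingEnd ℂ z) (starRingEnd ℂ v) := fun g v => by
    have := Complex.conjCLE.comp_right_fderiv (f := g) (x := z)
    exact congrArg (fun L => L v) this
  have hre' : ∀ v, fderiv ℝ (fun w => (F w).re) (starRingEnd ℂ z) (starRingEnd ℂ v) =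
      fderiv ℝ (fun w => (F w).re) z v := fun v => by
    rw [← chain (fun w => (F w).re), hre.fderiv_eq]
  have him' : ∀ v, fderiv ℝ (fun w => (F w).im) (starRingEnd ℂ z) (starRingEnd ℂ v) =
      -fderiv ℝ (fun w => (F w).im) z v := fun v => by
    rw [← chain (fun w => (F w).im), him.fderiv_eq, fderiv_fun_neg]; rfl
  have r1 := hre' 1
  have r2 := hre' Complex.I
  have i1 := him' 1
  have i2 := him' Complex.I
  simp only [map_one, Complex.conj_I, map_neg, neg_inj] at r1 r2 i1 i2
  rw [neg_eq_iff_eq_neg] at r2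
  ext
  · simp only [dbar, Complexification.conj_re, r1, i2]
  · simp only [dbar, Complexification.conj_im, r2, i1, ← smul_neg, neg_add]

variable [SMulCommClass ℝ A A] [IsScalarTower ℝ A A] [FiniteDimensional ℝ A] [IsAlternative A]

/-- On the slice `ℂ_J` the operator `∂/∂z̄` is the Cauchy–Riemann operator for `a ↦ J a`. -/
theorem isLeftHolomorphicOn_iff_dbar {J : A} (hJ : J * J = -1) {D : Set ℂ}
    {F : ℂ → Complexification A}
    (hre : ∀ z ∈ D, DifferentiableAt ℝ (fun z => (F z).re) z)
    (him : ∀ z ∈ D, DifferentiableAt ℝ (fun z => (F z).im) z) :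
    IsLeftHolomorphicOn J D (fun z => (F z).re + J * (F z).im) ↔
      ∀ z ∈ D, (dbar F z).re + J * (dbar F z).im = 0 := by
  refine forall₂_congr fun z hz => ?_
  have hd : HasFDerivAt (fun z => (F z).re + J * (F z).im)
      (fderiv ℝ (fun w => (F w).re) z + (mulCLM A J).comp (fderiv ℝ (fun w => (F w).im) z)) z :=
    (hre z hz).hasFDerivAt.add ((mulCLM A J).hasFDerivAt.comp z (him z hz).hasFDerivAt)
  rw [hd.fderiv]
  simp only [hd.differentiableAt, true_and, add_apply, ContinuousLinearMap.comp_apply,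
    mulCLM_apply, dbar, mul_smul_comm, ← smul_add, mul_add, mul_mul_eq_neg hJ]
  generalize fderiv ℝ (fun w => (F w).re) z 1 = a
  generalize fderiv ℝ (fun w => (F w).re) z Complex.I = c
  generalize fderiv ℝ (fun w => (F w).im) z 1 = b
  generalize fderiv ℝ (fun w => (F w).im) z Complex.I = d
  rw [smul_eq_zero_iff_right (by norm_num : (1 / 2 : ℝ) ≠ 0)]
  -- The two equations are `J` times each other.
  constructor
  · intro h
    have h' := congrArg (J * ·) h
    simp only [mul_add, mul_mul_eq_neg hJ, mul_neg] at h'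
    rw [← sub_eq_zero] at h'
    rw [← h']
    abel
  · intro h
    have h' := congrArg (J * ·) h
    simp only [mul_add, mul_sub, mul_mul_eq_neg hJ, mul_zero] at h'
    rw [← sub_eq_zero, ← neg_eq_zero, ← h']
    abel

end StemFunctions

/-! ### Stem functions determined by one slice -/

section Extension

variable {A : Type*} [NormedNonAssocRing A] [NormedSpace ℝ A]

/-- The stem function recovered from the values of a slice function on the single slice `ℂ_J`:
`F₁(z) = (g(z) + g(z̄)) / 2` and `F₂(z) = -J (g(z) - g(z̄)) / 2`, where `g = f ∘ Φ_J`. -/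
noncomputable def stemOfSlice (J : A) (g : ℂ → A) (z : ℂ) : Complexification A where
  re := (1 / 2 : ℝ) • (g z + g (starRingEnd ℂ z))
  im := -((1 / 2 : ℝ) • (J * (g z - g (starRingEnd ℂ z))))

theorem isStemOn_stemOfSlice (J : A) (D : Set ℂ) (g : ℂ → A) :
    IsStemOn D (stemOfSlice J g) := by
  intro z _
  ext
  · simp [stemOfSlice, add_comm]
  · simp only [stemOfSlice, Complex.conj_conj, Complexification.conj_im, neg_neg]
    rw [← smul_neg, ← mul_neg, neg_sub]

variable [IsAlternative A]

theorem eq_stemOfSlice {J : A} (hJ : J * J = -1) {D : Set ℂ} {F : ℂ → Complexification A}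
    (hF : IsStemOn D F) {z : ℂ} (hz : z ∈ D) :
    F z = stemOfSlice J (fun w => (F w).re + J * (F w).im) z := by
  have h := hF z hz
  ext
  · simp only [stemOfSlice, h, Complexification.conj_re, Complexification.conj_im, mul_neg]
    module
  · simp only [stemOfSlice, h, Complexification.conj_re, Complexification.conj_im, mul_neg,
      mul_add, mul_sub, mul_mul_eq_neg hJ]
    module

variable [SMulCommClass ℝ A A]

theorem stemOfSlice_re_add {J : A} (hJ : J * J = -1) (g : ℂ → A) (z : ℂ) :
    (stemOfSlice J g z).re + J * (stemOfSlice J g z).im = g z := by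
  simp only [stemOfSlice, mul_neg, mul_smul_comm, mul_mul_eq_neg hJ]
  module

theorem stemOfSlice_re_sub {J : A} (hJ : J * J = -1) (g : ℂ → A) (z : ℂ) :
    (stemOfSlice J g z).re + -J * (stemOfSlice J g z).im = g (starRingEnd ℂ z) := by
  simp only [stemOfSlice, mul_neg, neg_mul, mul_smul_comm, mul_mul_eq_neg hJ]
  module

variable [IsScalarTower ℝ A A] [FiniteDimensional ℝ A]

/-- A power series with real centre that converges on the slice `ℂ_J` converges on every slice,
with the same coefficients, to the slice function extending its sum: the powers of `z - p`
take conjugate values at conjugate points. -/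
theorem tendsto_stemOfSlice {J : A} (hJ : J * J = -1) (K : A) {p r : ℝ} {a : ℕ → A} {g : ℂ → A}
    (h : ∀ z ∈ Metric.ball (p : ℂ) r, Tendsto
      (fun N : ℕ => ∑ n ∈ Finset.range N, Phi J ((z - p) ^ n) * a n) atTop (𝓝 (g z)))
    {z : ℂ} (hz : z ∈ Metric.ball (p : ℂ) r) :
    Tendsto (fun N : ℕ => ∑ n ∈ Finset.range N, Phi K ((z - p) ^ n) * a n) atTop
      (𝓝 ((stemOfSlice J g z).re + K * (stemOfSlice J g z).im)) := by
  have hz' : starRingEnd ℂ z ∈ Metric.ball (p : ℂ) r := by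
    rw [mem_ball_iff_norm] at hz ⊢
    rwa [← Complex.norm_conj, map_sub, Complex.conj_conj, Complex.conj_ofReal]
  have hc : ∀ L : A, Continuous fun x => L * x := fun L => (mulCLM A L).continuous
  have h1 := ((h z hz).add (h _ hz')).const_smul (1 / 2 : ℝ)
  have h2 := ((((hc J).tendsto _).comp ((h z hz).sub (h _ hz'))).const_smul (1 / 2 : ℝ)).neg
  refine (h1.add (((hc K).tendsto _).comp h2)).congr fun N => ?_
  simp only [Function.comp_apply, ← Finset.sum_add_distrib, ← Finset.sum_sub_distrib,
    Finset.mul_sum, Finset.smul_sum, ← Finset.sum_neg_distrib]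
  refine Finset.sum_congr rfl fun n _ => ?_
  have hconj : (starRingEnd ℂ z - p) ^ n = starRingEnd ℂ ((z - p) ^ n) := by
    simp
  rw [hconj]
  generalize (z - (p : ℂ)) ^ n = c
  simp only [Phi, Complex.conj_re, Complex.conj_im, add_mul, smul_mul_assoc, one_mul, mul_sub,
    mul_add, mul_smul_comm, mul_mul_eq_neg hJ, mul_neg]
  module

/-- The values of `f` on `ℂ_J` extend to a holomorphic stem function if `f` is holomorphic on
`ℂ_J` for both complex structures `J` and `-J`. -/
theorem contDiffOn_stemOfSlice {D : Set ℂ} (hD : IsOpen D)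
    (hDconj : ∀ z ∈ D, starRingEnd ℂ z ∈ D) {J : A} (hJ : J * J = -1) {f : A → A}
    (h : IsLeftHolomorphicOn J D fun z => f (Phi J z))
    (h' : IsLeftHolomorphicOn (-J) D fun z => f (Phi (-J) z)) :
    ContDiffOn ℝ 1 (fun z => (stemOfSlice J (fun w => f (Phi J w)) z).re) D ∧
    ContDiffOn ℝ 1 (fun z => (stemOfSlice J (fun w => f (Phi J w)) z).im) D ∧
    ∀ z ∈ D, dbar (stemOfSlice J fun w => f (Phi J w)) z = ⟨0, 0⟩ := by
  set F := stemOfSlice J fun w => f (Phi J w) with hF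
  have hg := h.contDiffOn hJ hD
  have hgc : ContDiffOn ℝ 1 (fun z => f (Phi J (starRingEnd ℂ z))) D :=
    hg.comp Complex.conjCLE.contDiff.contDiffOn fun z hz => hDconj z hz
  have h1 : ContDiffOn ℝ 1 (fun z => (F z).re) D := (hg.add hgc).const_smul (1 / 2 : ℝ)
  have h2 : ContDiffOn ℝ 1 (fun z => (F z).im) D :=
    (((mulCLM A J).contDiff.comp_contDiffOn (hg.sub hgc)).const_smul (1 / 2 : ℝ)).neg
  refine ⟨h1, h2, fun z hz => ?_⟩
  have d1 : ∀ z ∈ D, DifferentiableAt ℝ (fun z => (F z).re) z := fun z hz =>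
    (h1.differentiableOn one_ne_zero).differentiableAt (hD.mem_nhds hz)
  have d2 : ∀ z ∈ D, DifferentiableAt ℝ (fun z => (F z).im) z := fun z hz =>
    (h2.differentiableOn one_ne_zero).differentiableAt (hD.mem_nhds hz)
  have e1 : (dbar F z).re + J * (dbar F z).im = 0 := by
    refine (isLeftHolomorphicOn_iff_dbar hJ d1 d2).1 ?_ z hz
    simpa only [hF, stemOfSlice_re_add hJ] using h
  have e2 : (dbar F z).re + -J * (dbar F z).im = 0 := by
    refine (isLeftHolomorphicOn_iff_dbar (by rw [neg_mul_neg, hJ]) d1 d2).1 ?_ z hz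
    simpa only [hF, stemOfSlice_re_sub hJ, Phi_neg] using h'
  have hre : (dbar F z).re = 0 := by
    have : (2 : ℝ) • (dbar F z).re = 0 := by
      rw [← add_zero (0 : A)]
      nth_rewrite 1 [← e1]
      rw [← e2, neg_mul]
      module
    exact (smul_eq_zero.1 this).resolve_left two_ne_zero
  have him : (dbar F z).im = 0 := by
    have := congrArg (J * ·) e1
    simpa [hre, mul_mul_eq_neg hJ] using this
  exact Complexification.ext hre him

end Extension

/-! ### Slice regularity and `σ_A`-analyticity -/

section Characterisation

variable {A : Type*} [NormedNonAssocRing A] [NormedSpace ℝ A] [StarRing A]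

theorem IsSliceRegularOn.isSliceOn {D : Set ℂ} {f : A → A} (hf : IsSliceRegularOn D f) :
    IsSliceOn D f := by
  obtain ⟨F, hF, -, -, h, -⟩ := hf
  exact ⟨F, hF, h⟩

variable [StarModule ℝ A] [SMulCommClass ℝ A A] [IsScalarTower ℝ A A]

/-- The representation formula: a slice function is determined by its values on one slice. -/
theorem IsSliceOn.apply_Phi [IsAlternative A] {D : Set ℂ}
    (hDconj : ∀ z ∈ D, starRingEnd ℂ z ∈ D) {f : A → A}
    (hf : IsSliceOn D f) {J K : A} (hJ : J ∈ imaginaryUnits A) (hK : K ∈ imaginaryUnits A)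
    {z : ℂ} (hz : z ∈ D) :
    f (Phi K z) = (stemOfSlice J (fun w => f (Phi J w)) z).re +
      K * (stemOfSlice J (fun w => f (Phi J w)) z).im := by
  obtain ⟨F, hF, hfF⟩ := hf
  have hv : ∀ {L : A}, L ∈ imaginaryUnits A → ∀ {w : ℂ}, w ∈ D →
      f (Phi L w) = (F w).re + L * (F w).im := fun hL w hw => by
    rw [hfF (Phi_mem_circularSet hL hw), inducedFun_Phi hF hL hw]
  have hz' := hDconj z hz
  have : F z = stemOfSlice J (fun w => f (Phi J w)) z := by
    rw [eq_stemOfSlice hJ.2 hF hz]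
    simp only [stemOfSlice, hv hJ hz, hv hJ hz']
  rw [hv hK hz, this]

variable [FiniteDimensional ℝ A]

/-- The map `α + β J ↦ α + i |β|` is continuous on the quadratic cone, so the upper half of `D`
is connected if `O_D` is; a real point then joins it to its mirror image. -/
theorem isPreconnected_of_isConnected_circularSet [Nontrivial A]
    (hnorm : ∀ x ∈ quadraticCone A, x * star x = (‖x‖ ^ 2) • (1 : A))
    {D : Set ℂ} (hDconj : ∀ z ∈ D, starRingEnd ℂ z ∈ D)
    (hconn : IsConnected (circularSet A D)) {p : ℝ} (hp : (p : ℂ) ∈ D) : IsPreconnected D := by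
  obtain ⟨φ, hφ⟩ := SeparatingDual.exists_eq_one (R := ℝ) (one_ne_zero (α := A))
  have hstar : Continuous (star : A → A) :=
    LinearMap.continuous_of_finiteDimensional
      ({ toFun := star, map_add' := star_add, map_smul' := fun r x => by simp } : A →ₗ[ℝ] A)
  let m : A → ℂ := fun x => ⟨φ (rePart x), ‖imPart x‖⟩
  have hm : Continuous m := by
    have : m = fun x => Complex.equivRealProdCLM.symm (φ (rePart x), ‖imPart x‖) := by
      funext x; rfl
    rw [this]
    unfold rePart imPart
    fun_prop
  have hmPhi : ∀ J ∈ imaginaryUnits A, ∀ z : ℂ, m (Phi J z) = ⟨z.re, |z.im|⟩ := by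
    intro J hJ z
    have hJ1 : ‖J‖ = 1 := by
      have := norm_Phi hnorm hJ Complex.I
      simpa [Phi] using this
    simp only [m, rePart_Phi hJ, imPart_Phi hJ, map_smul, hφ, norm_smul, hJ1, mul_one,
      smul_eq_mul, Real.norm_eq_abs]
  have hcases : ∀ z : ℂ, (⟨z.re, |z.im|⟩ : ℂ) = z ∨ (⟨z.re, |z.im|⟩ : ℂ) = starRingEnd ℂ z := by
    intro z
    rcases abs_choice z.im with h | h
    · exact Or.inl (Complex.ext rfl h)
    · exact Or.inr (Complex.ext rfl h)
  obtain ⟨J, hJ⟩ : (imaginaryUnits A).Nonempty := by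
    obtain ⟨_, -, _, -, J, hJ, -⟩ := hconn.nonempty
    exact ⟨J, hJ⟩
  have hU : IsPreconnected (m '' circularSet A D) :=
    hconn.isPreconnected.image m hm.continuousOn
  have hU' : IsPreconnected (starRingEnd ℂ '' (m '' circularSet A D)) :=
    hU.image _ Complex.continuous_conj.continuousOn
  have hpU : (p : ℂ) ∈ m '' circularSet A D :=
    ⟨Phi J p, Phi_mem_circularSet hJ hp, by rw [hmPhi J hJ]; exact Complex.ext rfl (by simp)⟩
  have hUD : m '' circularSet A D ⊆ D := by
    rintro _ ⟨_, ⟨-, z, hz, K, hK, rfl⟩, rfl⟩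
    rw [hmPhi K hK]
    rcases hcases z with h | h
    · rwa [h]
    · rw [h]; exact hDconj z hz
  have hDU : D = m '' circularSet A D ∪ starRingEnd ℂ '' (m '' circularSet A D) := by
    refine Set.Subset.antisymm (fun z hz => ?_) (Set.union_subset hUD ?_)
    · have hmz : m (Phi J z) ∈ m '' circularSet A D := ⟨_, Phi_mem_circularSet hJ hz, rfl⟩
      rw [hmPhi J hJ] at hmz
      rcases hcases z with h | h
      · exact Or.inl (h ▸ hmz)
      · exact Or.inr ⟨_, hmz, by rw [h, Complex.conj_conj]⟩
    · rintro _ ⟨z, hz, rfl⟩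
      exact hDconj z (hUD hz)
  rw [hDU]
  exact hU.union (p : ℂ) hpU ⟨p, hpU, Complex.conj_ofReal p⟩ hU'

variable [IsAlternative A]

theorem IsSliceRegularOn.isLeftHolomorphicOn {D : Set ℂ} (hD : IsOpen D)
    {f : A → A} (hf : IsSliceRegularOn D f) {J : A} (hJ : J ∈ imaginaryUnits A) :
    IsLeftHolomorphicOn J D fun z => f (Phi J z) := by
  obtain ⟨F, hF, h1, h2, hfF, hdbar⟩ := hf
  have h : IsLeftHolomorphicOn J D (fun z => (F z).re + J * (F z).im) := by
    refine (isLeftHolomorphicOn_iff_dbar hJ.2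
      (fun z hz => (h1.differentiableOn one_ne_zero).differentiableAt (hD.mem_nhds hz))
      (fun z hz => (h2.differentiableOn one_ne_zero).differentiableAt (hD.mem_nhds hz))).2
      fun z hz => ?_
    rw [← inducedFun_Phi (isStemOn_dbar hD hF) hJ hz]
    exact hdbar _ (Phi_mem_circularSet hJ hz)
  refine h.congr hD fun z hz => ?_
  simp only [hfF (Phi_mem_circularSet hJ hz), inducedFun_Phi hF hJ hz]

theorem IsSliceOn.isSliceRegularOn {D : Set ℂ} (hD : IsOpen D)
    (hDconj : ∀ z ∈ D, starRingEnd ℂ z ∈ D) (hne : (imaginaryUnits A).Nonempty) {f : A → A}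
    (hf : IsSliceOn D f)
    (h : ∀ J ∈ imaginaryUnits A, IsLeftHolomorphicOn J D fun z => f (Phi J z)) :
    IsSliceRegularOn D f := by
  obtain ⟨J, hJ⟩ := hne
  obtain ⟨h1, h2, h3⟩ := contDiffOn_stemOfSlice hD hDconj hJ.2 (h J hJ)
    (h _ (neg_mem_imaginaryUnits hJ))
  have hst := isStemOn_stemOfSlice J D fun z => f (Phi J z)
  refine ⟨_, hst, h1, h2, ?_, ?_⟩
  · rintro x ⟨-, z, hz, K, hK, rfl⟩
    rw [inducedFun_Phi hst hK hz, hf.apply_Phi hDconj hJ hK hz]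
  · rintro x ⟨-, z, hz, K, hK, rfl⟩
    rw [inducedFun_Phi (isStemOn_dbar hD hst) hK hz, h3 z hz]
    simp

/-- Holomorphy on the slices yields `σ_A`-analyticity. Around a non-real point a `σ_A`-ball
that does not reach the real axis lies in one slice, so the Taylor series of the restriction to
that slice serves; around a real point the Taylor series on one slice serves on all of them. -/
theorem IsSliceOn.isSigmaAnalyticOn [Nontrivial A]
    (hnorm : ∀ x ∈ quadraticCone A, x * star x = (‖x‖ ^ 2) • (1 : A))
    {D : Set ℂ} (hD : IsOpen D) (hDconj : ∀ z ∈ D, starRingEnd ℂ z ∈ D) {f : A → A}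
    (hf : IsSliceOn D f)
    (h : ∀ J ∈ imaginaryUnits A, IsLeftHolomorphicOn J D fun z => f (Phi J z)) :
    IsSigmaAnalyticOn (circularSet A D) f := by
  rintro y ⟨-, w, hw, J, hJ, rfl⟩
  obtain ⟨ε, hε, hεD⟩ := Metric.isOpen_iff.1 hD w hw
  by_cases hw0 : w.im = 0
  · obtain ⟨p, rfl⟩ : ∃ p : ℝ, w = p := ⟨w.re, Complex.ext rfl (by simpa using hw0)⟩
    obtain ⟨a, ha⟩ := ((h J hJ).mono hεD).exists_tendsto hJ.2
    have hball : ∀ x ∈ sigmaBall (Phi J (p : ℂ)) ε, ∃ K ∈ imaginaryUnits A,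
        ∃ z ∈ Metric.ball (p : ℂ) ε, x = Phi K z := fun x hx =>
      exists_of_mem_sigmaBall_real hnorm ⟨J, hJ⟩ (by rwa [Phi_ofReal] at hx)
    refine ⟨ε, hε, fun x hx => ?_, a, fun x hx => ?_⟩
    · obtain ⟨K, hK, z, hz, rfl⟩ := hball x hx
      exact Phi_mem_circularSet hK (hεD hz)
    · obtain ⟨K, hK, z, hz, rfl⟩ := hball x hx
      have hJK : Phi J (p : ℂ) = Phi K (p : ℂ) := by rw [Phi_ofReal, Phi_ofReal]
      simp only [hJK, slicePow_eq_Phi hK]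
      rw [hf.apply_Phi hDconj hJ hK (hεD hz)]
      exact tendsto_stemOfSlice hJ.2 K ha hz
  · have hsub : Metric.ball w (min ε |w.im|) ⊆ D :=
      (Metric.ball_subset_ball (min_le_left _ _)).trans hεD
    obtain ⟨a, ha⟩ := ((h J hJ).mono hsub).exists_tendsto hJ.2
    refine ⟨min ε |w.im|, lt_min hε (abs_pos.2 hw0), fun x hx => ?_, a, fun x hx => ?_⟩
    · obtain ⟨z, hz, rfl⟩ := exists_of_mem_sigmaBall hnorm hJ hw0 (min_le_right _ _) hx
      exact Phi_mem_circularSet hJ (hsub hz)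
    · obtain ⟨z, hz, rfl⟩ := exists_of_mem_sigmaBall hnorm hJ hw0 (min_le_right _ _) hx
      simp only [slicePow_eq_Phi hJ]
      exact ha z hz

theorem IsSigmaAnalyticOn.isLeftHolomorphicOn [Nontrivial A]
    (hnorm : ∀ x ∈ quadraticCone A, x * star x = (‖x‖ ^ 2) • (1 : A))
    {D : Set ℂ} (hD : IsOpen D) {f : A → A} (hf : IsSigmaAnalyticOn (circularSet A D) f)
    {J : A} (hJ : J ∈ imaginaryUnits A) : IsLeftHolomorphicOn J D fun z => f (Phi J z) := by
  refine isLeftHolomorphicOn_of_tendsto hJ.2 hD fun w hw => ?_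
  obtain ⟨r, hr, -, a, ha⟩ := hf _ (Phi_mem_circularSet hJ hw)
  refine ⟨r, hr, a, fun z hz => ?_⟩
  simpa only [slicePow_eq_Phi hJ] using ha _ (Phi_mem_sigmaBall hnorm hJ hz)

/-- If `D` meets the real axis, `σ_A`-analyticity alone makes `f` a slice function: near a real
point the power series shows it, and the identity principle on each slice carries the
representation formula over the whole connected set `D`. -/
theorem IsSigmaAnalyticOn.isSliceOn [Nontrivial A]
    (hnorm : ∀ x ∈ quadraticCone A, x * star x = (‖x‖ ^ 2) • (1 : A))
    {D : Set ℂ} (hD : IsOpen D) (hDconj : ∀ z ∈ D, starRingEnd ℂ z ∈ D)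
    (hDc : IsPreconnected D) (hne : (imaginaryUnits A).Nonempty) {p : ℝ} (hp : (p : ℂ) ∈ D)
    {f : A → A} (hf : IsSigmaAnalyticOn (circularSet A D) f) : IsSliceOn D f := by
  have h := fun J (hJ : J ∈ imaginaryUnits A) => hf.isLeftHolomorphicOn hnorm hD hJ
  obtain ⟨J, hJ⟩ := hne
  obtain ⟨h1, h2, h3⟩ := contDiffOn_stemOfSlice hD hDconj hJ.2 (h J hJ)
    (h _ (neg_mem_imaginaryUnits hJ))
  have hst := isStemOn_stemOfSlice J D fun z => f (Phi J z)
  refine ⟨_, hst, ?_⟩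
  rintro x ⟨-, z, hz, K, hK, rfl⟩
  rw [inducedFun_Phi hst hK hz]
  have hext := (isLeftHolomorphicOn_iff_dbar hK.2
    (fun z hz => (h1.differentiableOn one_ne_zero).differentiableAt (hD.mem_nhds hz))
    (fun z hz => (h2.differentiableOn one_ne_zero).differentiableAt (hD.mem_nhds hz))).2
    fun z hz => by rw [h3 z hz]; simp
  refine (h K hK).eqOn_of_eventuallyEq hK.2 hD hDc hext hp ?_ hz
  obtain ⟨r, hr, -, a, ha⟩ := hf _ (Phi_mem_circularSet hJ hp)
  have hser : ∀ L ∈ imaginaryUnits A, ∀ w ∈ Metric.ball (p : ℂ) r, Tendsto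
      (fun N : ℕ => ∑ n ∈ Finset.range N, Phi L ((w - p) ^ n) * a n) atTop
      (𝓝 (f (Phi L w))) := fun L hL w hw => by
    have hJL : Phi J (p : ℂ) = Phi L (p : ℂ) := by rw [Phi_ofReal, Phi_ofReal]
    have := ha (Phi L w) (by rw [hJL]; exact Phi_mem_sigmaBall hnorm hL hw)
    simpa only [hJL, slicePow_eq_Phi hL] using this
  filter_upwards [Metric.ball_mem_nhds (p : ℂ) hr] with w hw
  exact tendsto_nhds_unique (hser K hK w hw) (tendsto_stemOfSlice hJ.2 K (hser J hJ) hw)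

end Characterisation

end SliceAnalysis

theorem mainTheorem1 {A : Type*} [NormedNonAssocRing A] [NormedSpace ℝ A]
    [SMulCommClass ℝ A A] [IsScalarTower ℝ A A] [FiniteDimensional ℝ A] [IsAlternative A]
    [StarRing A] [StarModule ℝ A]
    (hnorm : ∀ x ∈ quadraticCone A, x * star x = (‖x‖ ^ 2) • (1 : A))
    (D : Set ℂ) (hD : IsOpen D) (hDconj : ∀ z ∈ D, starRingEnd ℂ z ∈ D)
    (hconn : IsConnected (circularSet A D)) (f : A → A) :
    (D ∩ Set.range ((↑) : ℝ → ℂ) = ∅ →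
      (IsSliceRegularOn D f ↔ IsSliceOn D f ∧ IsSigmaAnalyticOn (circularSet A D) f)) ∧
    (D ∩ Set.range ((↑) : ℝ → ℂ) ≠ ∅ →
      (IsSliceRegularOn D f ↔ IsSigmaAnalyticOn (circularSet A D) f)) := by
  rcases subsingleton_or_nontrivial A with hA | hA
  · -- In the zero algebra every function is slice regular and `σ_A`-analytic.
    have h1 : IsSliceRegularOn D f := ⟨fun _ => 1, fun _ _ => by ext <;> simp,
      contDiffOn_const, contDiffOn_const, fun _ _ => Subsingleton.elim _ _,
      fun _ _ => Subsingleton.elim _ _⟩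
    have h2 : IsSigmaAnalyticOn (circularSet A D) f := fun y hy =>
      ⟨1, one_pos, fun x _ => Subsingleton.elim y x ▸ hy, 0, fun x _ => by
        simp [Subsingleton.elim (f x) 0]⟩
    exact ⟨fun _ => iff_of_true h1 ⟨h1.isSliceOn, h2⟩, fun _ => iff_of_true h1 h2⟩
  have hne : (imaginaryUnits A).Nonempty := by
    obtain ⟨_, -, _, -, J, hJ, -⟩ := hconn.nonempty
    exact ⟨J, hJ⟩
  have hforward : IsSliceRegularOn D f → IsSigmaAnalyticOn (circularSet A D) f := fun h =>
    h.isSliceOn.isSigmaAnalyticOn hnorm hD hDconj fun _ => h.isLeftHolomorphicOn hD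
  have hbackward : IsSliceOn D f → IsSigmaAnalyticOn (circularSet A D) f →
      IsSliceRegularOn D f := fun hs h =>
    hs.isSliceRegularOn hD hDconj hne fun _ => h.isLeftHolomorphicOn hnorm hD
  refine ⟨fun _ => ⟨fun h => ⟨h.isSliceOn, hforward h⟩, fun h => hbackward h.1 h.2⟩,
    fun hreal => ⟨hforward, fun h => ?_⟩⟩
  obtain ⟨_, hp, p, rfl⟩ := Set.nonempty_iff_ne_empty.2 hreal
  exact hbackward (h.isSliceOn hnorm hD hDconj
    (isPreconnected_of_isConnected_circularSet hnorm hDconj hconn hp) hne hp) h
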